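/- Let $\mathbf{H}$ be a random $n\times m$ complex matrix and $\mathbf{z}$ a random vector in $\mathbb{C}^n$, independent of $\mathbf{H}$, and consider the channel $\mathbf{y}=\mathbf{H}\mathbf{x}+\mathbf{z}$, whose input $\mathbf{x}\in\mathbb{C}^m$ is a random vector such that $\mathbf{x}$, $\mathbf{H}$ and $\mathbf{z}$ are independent. A random vector $\mathbf{v}\in\mathbb{C}^k$ is called \emph{circular} if $e^{2\pi i\theta}\mathbf{v}$ has the same distribution as $\mathbf{v}$ for every $\theta\in[0,1)$; its \emph{circular analog} is $\mathbf{v}_{(a)}=e^{2\pi i\psi}\mathbf{v}$, where $\psi$ is uniformly distributed on $[0,1)$ and independent of $\mathbf{v}$. Let $\mathcal{I}$ be a set of probability distributions on $\mathbb{C}^m$ (the admissible input distributions; we write $\mathbf{x}\in\mathcal{I}$ if the distribution of $\mathbf{x}$ belongs to $\mathcal{I}$) that is \emph{circular-closed}: $\mathbf{x}\in\mathcal{I}$ implies $\mathbf{x}_{(a)}\in\mathcal{I}$. The \emph{noncoherent capacity} of the channel is $$C=\sup_{\mathbf{x}\in\mathcal{I}} I(\mathbf{x};\mathbf{y})\in[0,\infty],$$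 where the mutual information $I(\mathbf{x};\mathbf{y})\in[0,\infty]$ is the Kullback--Leibler divergence of the joint distribution of $(\mathbf{x},\mathbf{y})$ from the product of its marginals (when densities exist, $I(\mathbf{x};\mathbf{y})=\int f_{\mathbf{x},\mathbf{y}}\log\frac{f_{\mathbf{x},\mathbf{y}}}{f_{\mathbf{x}}f_{\mathbf{y}}}$). An input $\mathbf{x}\in\mathcal{I}$ is \emph{capacity-achieving} if $I(\mathbf{x};\mathbf{y})=C$. Suppose that $\mathbf{z}$ is circular and that a capacity-achieving $\mathbf{x}'\in\mathcal{I}$ exists. Then there exists a circular random vector $\mathbf{x}\in\mathcal{I}$ that achieves the noncoherent capacity. -/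

import Mathlib

open MeasureTheory ProbabilityTheory
open scoped ENNReal

namespace NoncoherentCapacity

/-- The unit complex number `e^{j 2 π θ}`. -/
noncomputable def phase (θ : ℝ) : ℂ :=
  Complex.exp (2 * Real.pi * θ * Complex.I)

/-- A random vector with law `μ` on `ℂᵏ` is circular: its law is the law of `e^{j 2 π θ} x`
for every `θ ∈ [0, 1)`. -/
def IsCircular {k : ℕ} (μ : Measure (Fin k → ℂ)) : Prop :=
  ∀ θ ∈ Set.Ico (0 : ℝ) 1, μ.map (fun x => phase θ • x) = μ

/-- The law of the circular analog `e^{j 2 π ψ} x` of a random vector `x` with law `μ`, where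
`ψ` is uniformly distributed on `[0, 1)` and independent of `x`. -/
noncomputable def circularAnalog {k : ℕ} (μ : Measure (Fin k → ℂ)) : Measure (Fin k → ℂ) :=
  ((volume.restrict (Set.Ico (0 : ℝ) 1)).prod μ).map (fun p => phase p.1 • p.2)

/-- A set of admissible input laws is circular-closed. -/
def IsCircularClosed {k : ℕ} (A : Set (Measure (Fin k → ℂ))) : Prop :=
  ∀ μ ∈ A, circularAnalog μ ∈ A

/-- Mutual information `I(x; y)` of a pair `(x, y)` with joint law `ρ`: the Kullback-Leibler
divergence of the joint law from the product of its marginals, with values in `[0, ∞]`. -/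
noncomputable def mutualInfo {α β : Type*} [MeasurableSpace α] [MeasurableSpace β]
    (ρ : Measure (α × β)) : ℝ≥0∞ :=
  InformationTheory.klDiv ρ (ρ.fst.prod ρ.snd)

section Channel

variable {n m : ℕ} {Ω : Type*} [MeasurableSpace Ω]

/-- The joint law of `(x, y)`, `y = H x + z`, when the input `x` has law `μ` and is independent
of the pair `(H, z)`, which is defined on the probability space `(Ω, P)`. -/
noncomputable def inputOutputLaw (P : Measure Ω) (H : Ω → Matrix (Fin n) (Fin m) ℂ)
    (z : Ω → Fin n → ℂ) (μ : Measure (Fin m → ℂ)) : Measure ((Fin m → ℂ) × (Fin n → ℂ)) :=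
  (μ.prod P).map (fun p => (p.1, (H p.2).mulVec p.1 + z p.2))

/-- The noncoherent capacity `C = sup_{x ∈ A} I(x; y)` of `y = H x + z`. -/
noncomputable def capacity (P : Measure Ω) (H : Ω → Matrix (Fin n) (Fin m) ℂ)
    (z : Ω → Fin n → ℂ) (A : Set (Measure (Fin m → ℂ))) : ℝ≥0∞ :=
  ⨆ μ ∈ A, mutualInfo (inputOutputLaw P H z μ)

/-- The input law `μ` is admissible and `I(x; y) = C`. -/
def IsCapacityAchieving (P : Measure Ω) (H : Ω → Matrix (Fin n) (Fin m) ℂ)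
    (z : Ω → Fin n → ℂ) (A : Set (Measure (Fin m → ℂ))) (μ : Measure (Fin m → ℂ)) : Prop :=
  μ ∈ A ∧ mutualInfo (inputOutputLaw P H z μ) = capacity P H z A

end Channel

end NoncoherentCapacity

namespace NoncoherentCapacity

open InformationTheory

section Divergence

/-! The circular analog of any input carries at least as much information, so that of an optimal
input is optimal. Let `Q` be the output law produced by the circular analog; it is circular because
the channel commutes in law with phases (`isCircular_map_of_equivariant`). Measured against `Q`
instead of its own output law, the original input has divergence at least its mutual information
(`mutualInfo_le_klDiv_fst_prod`). This divergence is in turn at most the one for the rotated input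
(`klDiv_le_klDiv_circularAnalog`), which is exactly a mutual information. The second bound is data
processing: resample the phase given the rotated input, then undo it on input and output. This sends
the rotated joint law to the original one and, as `Q` is circular, the rotated product to the
original product. No densities or finiteness are needed. -/

/-- Replacing the second marginal by any other law does not decrease the divergence of a joint law
from the product of its marginals. -/
theorem mutualInfo_le_klDiv_fst_prod {α β : Type*} [MeasurableSpace α] [StandardBorelSpace α]
    [Nonempty α] [MeasurableSpace β] (ρ : Measure (α × β)) [IsProbabilityMeasure ρ]
    (Q : Measure β) [IsProbabilityMeasure Q] :
    mutualInfo ρ ≤ klDiv ρ (ρ.fst.prod Q) := by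
  have hswap : (ρ.map Prod.swap).fst = ρ.snd := by
    rw [Measure.fst, Measure.map_map measurable_fst measurable_swap]; rfl
  have hρ : IsProbabilityMeasure (ρ.map Prod.swap) :=
    Measure.isProbabilityMeasure_map measurable_swap.aemeasurable
  have hdis : ρ.snd ⊗ₘ (ρ.map Prod.swap).condKernel = ρ.map Prod.swap := by
    rw [← hswap]; exact Measure.disintegrate _ _
  calc mutualInfo ρ
      = klDiv ((ρ.map Prod.swap).map Prod.swap) ((ρ.snd.prod ρ.fst).map Prod.swap) := by
        rw [Measure.map_map measurable_swap measurable_swap, Measure.prod_swap]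
        simp [mutualInfo]
    _ ≤ klDiv (ρ.map Prod.swap) (ρ.snd.prod ρ.fst) := klDiv_map_le _ _ measurable_swap
    _ = klDiv (ρ.snd ⊗ₘ (ρ.map Prod.swap).condKernel) (ρ.snd ⊗ₘ Kernel.const β ρ.fst) := by
        rw [hdis, Measure.compProd_const]
    -- The chain rule conditions on the first coordinate, hence the swap; the discarded term is
    -- `klDiv ρ.snd Q`.
    _ ≤ klDiv (ρ.snd ⊗ₘ (ρ.map Prod.swap).condKernel) (Q ⊗ₘ Kernel.const β ρ.fst) := by
        rw [klDiv_compProd_eq_add ρ.snd Q]; exact le_add_self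
    _ = klDiv (ρ.map Prod.swap) ((ρ.fst.prod Q).map Prod.swap) := by
        rw [hdis, Measure.compProd_const, Measure.prod_swap]
    _ ≤ klDiv ρ (ρ.fst.prod Q) := klDiv_map_le _ _ measurable_swap

/-- If `(x, u)` has law `L` and is independent of `ω`, then sampling `u` from its conditional law
given `x` completes the pair `(x, g (x, ω))` to the triple `(x, g (x, ω), u)`. -/
theorem map_compProd_comap_condKernel {α β γ Ω : Type*} [MeasurableSpace α] [MeasurableSpace β]
    [StandardBorelSpace β] [Nonempty β] [MeasurableSpace γ] [MeasurableSpace Ω]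
    (L : Measure (α × β)) [IsFiniteMeasure L] (P : Measure Ω) [IsFiniteMeasure P]
    {g : α × Ω → γ} (hg : Measurable g) :
    ((L.fst.prod P).map fun p => (p.1, g p)) ⊗ₘ (L.condKernel.comap Prod.fst measurable_fst) =
      (L.prod P).map fun p => ((p.1.1, g (p.1.1, p.2)), p.1.2) := by
  refine Measure.ext_of_lintegral _ fun f hf => ?_
  rw [Measure.lintegral_compProd hf,
    lintegral_map (Measurable.lintegral_kernel_prod_right' hf) (by fun_prop),
    lintegral_map hf (by fun_prop), lintegral_prod, lintegral_prod _ (by fun_prop)]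
  · conv_rhs => rw [← Measure.disintegrate L L.condKernel]
    rw [Measure.lintegral_compProd (Measurable.lintegral_prod_right'
      (f := fun p : (α × β) × Ω => f ((p.1.1, g (p.1.1, p.2)), p.1.2)) (by fun_prop))]
    refine lintegral_congr fun x => ?_
    simp only [Kernel.comap_apply]
    -- Given `x`, the variables `ω` and `u` are independent, so the order of sampling is irrelevant.
    exact lintegral_lintegral_swap (f := fun ω u => f ((x, g (x, ω)), u)) (by fun_prop)
  · exact ((Measurable.lintegral_kernel_prod_right' hf).comp
      (by fun_prop : Measurable fun p : α × Ω => (p.1, g p))).aemeasurable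

end Divergence

/-! ### Phases and the uniform law on the circle. -/

section Phase

theorem phase_add (s t : ℝ) : phase (s + t) = phase s * phase t := by
  rw [phase, phase, phase, ← Complex.exp_add]
  push_cast
  ring_nf

theorem phase_zero : phase 0 = 1 := by simp [phase]

theorem phase_neg_mul_phase (t : ℝ) : phase (-t) * phase t = 1 := by
  rw [← phase_add, neg_add_cancel, phase_zero]

theorem phase_periodic : Function.Periodic phase 1 := fun t => by
  have h : phase 1 = 1 := by simp [phase]
  rw [phase_add, h, mul_one]

@[fun_prop]
theorem measurable_phase : Measurable phase := by
  unfold phase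
  fun_prop

/-- A law that is invariant under the phases in `[0, 1)` is invariant under all phases. -/
theorem IsCircular.map_eq {k : ℕ} {μ : Measure (Fin k → ℂ)} (h : IsCircular μ) (θ : ℝ) :
    μ.map (fun x => phase θ • x) = μ := by
  have hθ : phase (Int.fract θ) = phase θ := by
    simpa using phase_periodic.sub_int_mul_eq (x := θ) ⌊θ⌋
  rw [← hθ]
  exact h _ ⟨Int.fract_nonneg θ, Int.fract_lt_one θ⟩

/-- The uniform law on `[0, 1)`. -/
noncomputable abbrev uniformIco : Measure ℝ := volume.restrict (Set.Ico (0 : ℝ) 1)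

instance : IsProbabilityMeasure uniformIco := ⟨by simp⟩

/-- Up to endpoints, the shifted interval is another fundamental domain for the integer
translations. -/
theorem lintegral_uniformIco_add {f : ℝ → ℝ≥0∞} (hf : Function.Periodic f 1) (θ : ℝ) :
    ∫⁻ t, f (θ + t) ∂uniformIco = ∫⁻ t, f t ∂uniformIco := by
  have hpre : (fun t => θ + t) ⁻¹' Set.Ioc θ (θ + 1) = Set.Ioc 0 1 := by
    ext t; simp
  have hshift := (measurePreserving_add_left (volume : Measure ℝ) θ).setLIntegral_comp_preimage_emb
    (measurableEmbedding_addLeft θ) f (Set.Ioc θ (θ + 1))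
  rw [hpre] at hshift
  have hper := (isAddFundamentalDomain_Ioc (zero_lt_one' ℝ) θ).setLIntegral_eq
    (isAddFundamentalDomain_Ioc (zero_lt_one' ℝ) 0) f hf.map_vadd_zmultiples
  rw [zero_add] at hper
  rw [uniformIco, Measure.restrict_congr_set Ico_ae_eq_Ioc, hshift, hper]

end Phase

section CircularAnalog

variable {k : ℕ}

theorem lintegral_circularAnalog (μ : Measure (Fin k → ℂ)) [IsProbabilityMeasure μ]
    {f : (Fin k → ℂ) → ℝ≥0∞} (hf : Measurable f) :
    ∫⁻ x, f x ∂circularAnalog μ = ∫⁻ x, ∫⁻ t, f (phase t • x) ∂uniformIco ∂μ := by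
  rw [circularAnalog, lintegral_map hf (by fun_prop), lintegral_prod_symm' _ (by fun_prop)]

theorem isCircular_circularAnalog (μ : Measure (Fin k → ℂ)) [IsProbabilityMeasure μ] :
    IsCircular (circularAnalog μ) := by
  intro θ _
  refine Measure.ext_of_lintegral _ fun f hf => ?_
  rw [lintegral_map hf (by fun_prop), lintegral_circularAnalog μ (by fun_prop),
    lintegral_circularAnalog μ hf]
  refine lintegral_congr fun x => ?_
  simp only [smul_smul, ← phase_add]
  exact lintegral_uniformIco_add (f := fun t => f (phase t • x))
    (fun t => by simp only [phase_periodic t]) θ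

end CircularAnalog

/-! ### Channels that commute in law with phases. -/

section Channel

variable {n m : ℕ} {Ω : Type*} [MeasurableSpace Ω] {P : Measure Ω} [IsProbabilityMeasure P]
  {g : (Fin m → ℂ) × Ω → Fin n → ℂ}

/-- If the channel `x ↦ g (x, ·)` commutes in law with phase rotations, then a circular input
gives a circular output. -/
theorem isCircular_map_of_equivariant (hg : Measurable g)
    (hgP : ∀ θ x, P.map (fun ω => phase θ • g (x, ω)) = P.map (fun ω => g (phase θ • x, ω)))
    {μ : Measure (Fin m → ℂ)} [IsProbabilityMeasure μ] (hμ : IsCircular μ) :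
    IsCircular ((μ.prod P).map g) := by
  intro θ _
  refine Measure.ext_of_lintegral _ fun f hf => ?_
  rw [lintegral_map hf (by fun_prop), lintegral_map (by fun_prop) hg, lintegral_map hf hg,
    lintegral_prod _ (by fun_prop), lintegral_prod _ (by fun_prop)]
  conv_rhs => rw [← hμ.map_eq θ]
  rw [lintegral_map (Measurable.lintegral_prod_right' (f := fun p => f (g p)) (by fun_prop))
    (by fun_prop)]
  refine lintegral_congr fun x => ?_
  have hx : Measurable fun ω => phase θ • g (x, ω) := by fun_prop
  have hx' : Measurable fun ω => g (phase θ • x, ω) := by fun_prop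
  rw [← lintegral_map hf hx, hgP, lintegral_map hf hx']

/-- Undoing the random rotation of the input recovers the original input-output law. -/
theorem map_phase_neg_smul_of_equivariant (hg : Measurable g)
    (hgP : ∀ θ x, P.map (fun ω => phase θ • g (x, ω)) = P.map (fun ω => g (phase θ • x, ω)))
    (μ : Measure (Fin m → ℂ)) [IsProbabilityMeasure μ] :
    (((((uniformIco.prod μ).map fun p => (phase p.1 • p.2, p.1)).prod P).map
        fun p => ((p.1.1, g (p.1.1, p.2)), p.1.2)).map
          fun q => (phase (-q.2) • q.1.1, phase (-q.2) • q.1.2)) =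
      (μ.prod P).map fun p => (p.1, g p) := by
  refine Measure.ext_of_lintegral _ fun f hf => ?_
  have hL : IsProbabilityMeasure
      ((uniformIco.prod μ).map fun p : ℝ × (Fin m → ℂ) => (phase p.1 • p.2, p.1)) :=
    Measure.isProbabilityMeasure_map (by fun_prop)
  rw [lintegral_map hf (by fun_prop), lintegral_map (by fun_prop) (by fun_prop),
    lintegral_prod _ (by fun_prop), lintegral_map _ (by fun_prop), lintegral_prod,
    lintegral_map hf (by fun_prop), lintegral_prod _ (by fun_prop)]
  · have key : ∀ (t : ℝ) (x : Fin m → ℂ),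
        ∫⁻ ω, f (phase (-t) • phase t • x, phase (-t) • g (phase t • x, ω)) ∂P =
          ∫⁻ ω, f (x, g (x, ω)) ∂P := fun t x => by
      -- Equivariance at the opposite phase cancels the rotation of the input.
      have h := hgP (-t) (phase t • x)
      rw [smul_smul, phase_neg_mul_phase, one_smul] at h ⊢
      rw [← lintegral_map (f := fun y => f (x, y)) (by fun_prop) (by fun_prop), h,
        lintegral_map (by fun_prop) (by fun_prop)]
    simp only [key, lintegral_const, measure_univ, mul_one]
  · refine ((Measurable.lintegral_prod_right'
      (f := fun p : (ℝ × (Fin m → ℂ)) × Ω => f (phase (-p.1.1) • phase p.1.1 • p.1.2,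
        phase (-p.1.1) • g (phase p.1.1 • p.1.2, p.2))) (by fun_prop))).aemeasurable
  · exact Measurable.lintegral_prod_right'
      (f := fun p : ((Fin m → ℂ) × ℝ) × Ω => f (phase (-p.1.2) • p.1.1,
        phase (-p.1.2) • g (p.1.1, p.2))) (by fun_prop)

/-- For a channel commuting in law with phase rotations and a circular reference output law,
rotating the input at random does not decrease the divergence from the reference. -/
theorem klDiv_le_klDiv_circularAnalog (hg : Measurable g)
    (hgP : ∀ θ x, P.map (fun ω => phase θ • g (x, ω)) = P.map (fun ω => g (phase θ • x, ω)))
    (μ : Measure (Fin m → ℂ)) [IsProbabilityMeasure μ]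
    {Q : Measure (Fin n → ℂ)} [IsProbabilityMeasure Q] (hQ : IsCircular Q) :
    klDiv ((μ.prod P).map fun p => (p.1, g p)) (μ.prod Q) ≤
      klDiv (((circularAnalog μ).prod P).map fun p => (p.1, g p))
        ((circularAnalog μ).prod Q) := by
  set L : Measure ((Fin m → ℂ) × ℝ) :=
    (uniformIco.prod μ).map fun p => (phase p.1 • p.2, p.1) with hLdef
  have hL : IsProbabilityMeasure L := Measure.isProbabilityMeasure_map (by fun_prop)
  have hfst : L.fst = circularAnalog μ := by
    rw [Measure.fst, hLdef, Measure.map_map measurable_fst (by fun_prop)]; rfl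
  have hfstp : IsProbabilityMeasure (circularAnalog μ) := hfst ▸ inferInstance
  have hρ : IsProbabilityMeasure
      (((circularAnalog μ).prod P).map fun p => (p.1, g p)) :=
    Measure.isProbabilityMeasure_map (by fun_prop)
  have h₁ := map_phase_neg_smul_of_equivariant hg hgP μ
  -- The product with `Q` is the joint law of a channel that ignores its input; circularity of `Q`
  -- is its equivariance.
  have h₂ := map_phase_neg_smul_of_equivariant (P := Q) (g := Prod.snd) measurable_snd
    (fun θ _ => by simpa using hQ.map_eq θ) μ
  rw [← hLdef, ← map_compProd_comap_condKernel L P hg, hfst] at h₁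
  rw [← hLdef, ← map_compProd_comap_condKernel L Q measurable_snd, hfst] at h₂
  simp only [Prod.mk.eta, Measure.map_id'] at h₂
  rw [← h₁, ← h₂]
  -- Both laws are extended by the same conditional law of the phase, which leaves the divergence
  -- unchanged.
  exact (klDiv_map_le _ _ (by fun_prop)).trans_eq (klDiv_compProd_left _ _ _)

theorem mutualInfo_le_mutualInfo_circularAnalog (hg : Measurable g)
    (hgP : ∀ θ x, P.map (fun ω => phase θ • g (x, ω)) = P.map (fun ω => g (phase θ • x, ω)))
    (μ : Measure (Fin m → ℂ)) [IsProbabilityMeasure μ] :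
    mutualInfo ((μ.prod P).map fun p => (p.1, g p)) ≤
      mutualInfo (((circularAnalog μ).prod P).map fun p => (p.1, g p)) := by
  have hμ' : IsProbabilityMeasure (circularAnalog μ) :=
    Measure.isProbabilityMeasure_map (by fun_prop)
  have hfst : ∀ (ν : Measure (Fin m → ℂ)) [IsProbabilityMeasure ν],
      ((ν.prod P).map fun p => (p.1, g p)).fst = ν := fun ν _ => by
    rw [Measure.fst_map_prodMk hg]; simp
  have hsnd : (((circularAnalog μ).prod P).map fun p => (p.1, g p)).snd =
      ((circularAnalog μ).prod P).map g := Measure.snd_map_prodMk measurable_fst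
  have hQ : IsProbabilityMeasure (((circularAnalog μ).prod P).map g) :=
    Measure.isProbabilityMeasure_map hg.aemeasurable
  have hρ : IsProbabilityMeasure ((μ.prod P).map fun p => (p.1, g p)) :=
    Measure.isProbabilityMeasure_map (by fun_prop)
  calc mutualInfo ((μ.prod P).map fun p => (p.1, g p))
      ≤ klDiv ((μ.prod P).map fun p => (p.1, g p))
          (μ.prod (((circularAnalog μ).prod P).map g)) := by
        simpa only [hfst] using mutualInfo_le_klDiv_fst_prod
          ((μ.prod P).map fun p => (p.1, g p)) (((circularAnalog μ).prod P).map g)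
    _ ≤ klDiv (((circularAnalog μ).prod P).map fun p => (p.1, g p))
          ((circularAnalog μ).prod (((circularAnalog μ).prod P).map g)) :=
        klDiv_le_klDiv_circularAnalog hg hgP μ
          (isCircular_map_of_equivariant hg hgP (isCircular_circularAnalog μ))
    _ = mutualInfo (((circularAnalog μ).prod P).map fun p => (p.1, g p)) := by
        rw [mutualInfo, hfst, hsnd]

/-! ### The additive noise channel as an instance. -/

theorem measurable_mulVec_add {H : Ω → Matrix (Fin n) (Fin m) ℂ} {z : Ω → Fin n → ℂ}
    (hH : ∀ i j, Measurable (fun ω => H ω i j)) (hz : Measurable z) :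
    Measurable fun p : (Fin m → ℂ) × Ω => (H p.2).mulVec p.1 + z p.2 := by
  refine Measurable.add (measurable_pi_lambda _ fun i => ?_) (hz.comp measurable_snd)
  simp only [Matrix.mulVec, dotProduct]
  exact Finset.measurable_sum _ fun j _ =>
    ((hH i j).comp measurable_snd).mul ((measurable_pi_apply j).comp measurable_fst)

/-- With circular noise independent of `H`, the channel `x ↦ H x + z` commutes in law with phase
rotations. -/
theorem map_phase_smul_mulVec_add {H : Ω → Matrix (Fin n) (Fin m) ℂ} {z : Ω → Fin n → ℂ}
    (hH : ∀ i j, Measurable (fun ω => H ω i j)) (hz : Measurable z)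
    (hindep : IndepFun (fun ω (ij : Fin n × Fin m) => H ω ij.1 ij.2) z P)
    (hcirc : IsCircular (P.map z)) (θ : ℝ) (x : Fin m → ℂ) :
    P.map (fun ω => phase θ • ((H ω).mulVec x + z ω)) =
      P.map (fun ω => (H ω).mulVec (phase θ • x) + z ω) := by
  set K : Ω → Fin n × Fin m → ℂ := fun ω ij => H ω ij.1 ij.2
  have hK : Measurable K := measurable_pi_lambda _ fun ij => hH ij.1 ij.2
  have hindep' : IndepFun K (fun ω => phase θ • z ω) P :=
    hindep.comp (φ := id) (ψ := fun w => phase θ • w) measurable_id (by fun_prop)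
  -- By independence the joint law is the product of its marginals, so rotating the noise alone does
  -- not change it.
  have hpair : P.map (fun ω => (K ω, phase θ • z ω)) = P.map (fun ω => (K ω, z ω)) := by
    rw [(indepFun_iff_map_prod_eq_prod_map_map hK.aemeasurable (by fun_prop)).1 hindep',
      (indepFun_iff_map_prod_eq_prod_map_map hK.aemeasurable hz.aemeasurable).1 hindep]
    congr 1
    conv_rhs => rw [← hcirc.map_eq θ]
    rw [Measure.map_map (by fun_prop) hz]
    rfl
  have hF : Measurable fun q : (Fin n × Fin m → ℂ) × (Fin n → ℂ) =>
      (Matrix.of fun i j => q.1 (i, j)).mulVec (phase θ • x) + q.2 := by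
    refine Measurable.add (measurable_pi_lambda _ fun i => ?_) measurable_snd
    simp only [Matrix.mulVec, dotProduct, Matrix.of_apply]
    fun_prop
  have h := congrArg (fun ν => ν.map fun q : (Fin n × Fin m → ℂ) × (Fin n → ℂ) =>
      (Matrix.of fun i j => q.1 (i, j)).mulVec (phase θ • x) + q.2) hpair
  rw [Measure.map_map hF (by fun_prop), Measure.map_map hF (by fun_prop)] at h
  simp only [smul_add, ← Matrix.mulVec_smul]
  exact h

end Channel

end NoncoherentCapacity

theorem mainTheorem6 {n m : ℕ} {Ω : Type*} [MeasurableSpace Ω]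
    (P : Measure Ω) [IsProbabilityMeasure P]
    (H : Ω → Matrix (Fin n) (Fin m) ℂ) (z : Ω → Fin n → ℂ)
    (hH : ∀ i j, Measurable (fun ω => H ω i j)) (hz : Measurable z)
    (hindep : IndepFun (fun ω (ij : Fin n × Fin m) => H ω ij.1 ij.2) z P)
    (hcirc : NoncoherentCapacity.IsCircular (P.map z))
    (A : Set (Measure (Fin m → ℂ)))
    (hA : ∀ μ ∈ A, IsProbabilityMeasure μ)
    (hclosed : NoncoherentCapacity.IsCircularClosed A)
    (hattained : ∃ μ, NoncoherentCapacity.IsCapacityAchieving P H z A μ) :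
    ∃ μ, NoncoherentCapacity.IsCircular μ ∧
      NoncoherentCapacity.IsCapacityAchieving P H z A μ := by
  obtain ⟨μ, hμA, hμ⟩ := hattained
  have := hA μ hμA
  refine ⟨NoncoherentCapacity.circularAnalog μ,
    NoncoherentCapacity.isCircular_circularAnalog μ, hclosed μ hμA, le_antisymm ?_ ?_⟩
  · exact le_iSup₂ (f := fun ν (_ : ν ∈ A) => NoncoherentCapacity.mutualInfo
      (NoncoherentCapacity.inputOutputLaw P H z ν)) _ (hclosed μ hμA)
  · rw [← hμ]
    exact NoncoherentCapacity.mutualInfo_le_mutualInfo_circularAnalog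
      (NoncoherentCapacity.measurable_mulVec_add hH hz)
      (NoncoherentCapacity.map_phase_smul_mulVec_add hH hz hindep hcirc) μ
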